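/- Let $m\ge 1$ be an integer and $\lambda,\mu>0$. Let $\mathbf A=[a_{i,j}]_{i,j\ge 0}$ be the generator of the $M/M(m,m)/1$ queue: $a_{i,i+1}=\lambda$; $a_{i,i}=-\lambda$ for $i<m$ and $a_{i,i}=-(\lambda+\mu)$ for $i\ge m$; $a_{i,i-m}=\mu$ for $i\ge m$; all other entries are $0$. Let $(Q_n)_{n\ge0}$ be the polynomials with $Q_n(x)=\lambda^{-n}(\lambda+x)^n$ for $0\le n\le m$ and $(\lambda+\mu+x)Q_n(x)=\lambda Q_{n+1}(x)+\mu Q_{n-m}(x)$ for $n\ge m$. Let $\mathbf q_r=(q_{0,r},\dots,q_{m-1,r})$, $r\ge -1$, be the polynomial vectors with $\mathbf q_{-1}=0$, with $\mathbf q_0,\dots,\mathbf q_{m-1}$ the standard unit vectors, and with $(\lambda+x)\mathbf q_r=\mu\mathbf q_{r+m}+\lambda\mathbf q_{r-1}$ for $0\le r<m$ and $(\lambda+\mu+x)\mathbf q_r=\mu\mathbf q_{r+m}+\lambda\mathbf q_{r-1}$ for $r\ge m$. Then there exist compactly supported distributions $\sigma_0,\dots,\sigma_{m-1}$ on the complex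 plane with $$\int Q_n(x)\sum_{j=0}^{m-1}q_{j,r}(x)\,d\sigma_j(x)=\delta_{n,r},\qquad n,r\ge 0, \tag{1}$$ and for every system $(\sigma_0,\dots,\sigma_{m-1})$ of compactly supported distributions on $\mathbb C$ satisfying (1) the functions $$P_{n,r}(t)=\int e^{xt}\,Q_n(x)\sum_{j=0}^{m-1}q_{j,r}(x)\,d\sigma_j(x),\qquad n,r\ge 0,$$ have the following properties. 1. Each $P_{n,r}$ is an entire function of $t\in\mathbb C$, and $\mathbf P=[P_{n,r}]$ solves the initial value problem $\mathbf P'(t)=\mathbf A\mathbf P(t)$, $t\ge 0$, $\mathbf P(0)=\mathbb I$. It is the only solution of this problem with entire entries. 2. For $t\ge0$ the entries are real and form a transition probability function: $P_{n,r}(t)\ge 0$ and $P_{n,r}(0)=\delta_{n,r}$; $\sum_{r\ge0}P_{n,r}(t)=1$; $P_{n,r}(s+t)=\sum_{k\ge0}P_{n,k}(s)P_{k,r}(t)$ for $s,t\ge0$; and $\lim_{t\to0^+}P_{n,r}(t)=\delta_{n,r}$. 3. On $[0,\infty)$, $\mathbf P$ is the only solution of the initial value problem that is a transition probability function. -/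

import Mathlib

open Filter Topology
open scoped ContDiff Polynomial

noncomputable section

namespace BulkQueue

/-- The generator of the `M/M(m,m)/1` queue (arrival rate `lam`, service rate `mu`,
batches of fixed size `m ≥ 1`), as an infinite matrix. -/
def generator (m : ℕ) (lam mu : ℝ) (i j : ℕ) : ℝ :=
  if j = i + 1 then lam
  else if j = i then (if i < m then -lam else -(lam + mu))
  else if i = j + m then mu
  else 0

/-- The polynomials `Q_n`: `Q_0 = 1`, `lam * Q_{n+1} = (lam + x) Q_n` for `n < m`, and
`lam * Q_{n+1} = (lam + mu + x) Q_n - mu * Q_{n-m}` for `n ≥ m`. -/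
def Q (m : ℕ) (lam mu : ℝ) : ℕ → ℝ[X]
  | 0 => 1
  | n + 1 =>
    if n < m then Polynomial.C (1 / lam) * ((Polynomial.X + Polynomial.C lam) * Q m lam mu n)
    else Polynomial.C (1 / lam) *
      ((Polynomial.X + Polynomial.C (lam + mu)) * Q m lam mu n -
        Polynomial.C mu * Q m lam mu (n - m))
termination_by n => n
decreasing_by all_goals omega

/-- The components `q_{j,r}` of the dual vector polynomials `q_r = (q_{0,r}, …, q_{m-1,r})`:
`q_0, …, q_{m-1}` are the standard unit vectors, `q_{-1} = 0`, and for `s ≥ 0`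
`mu * q_{s+m} = (lam + x) q_s - lam * q_{s-1}` if `s < m`,
`mu * q_{s+m} = (lam + mu + x) q_s - lam * q_{s-1}` if `s ≥ m`
(below `s = r - m`). The alternative `m = 0` only serves to make the recursion well-founded. -/
def q (m : ℕ) (lam mu : ℝ) (j : ℕ) (r : ℕ) : ℝ[X] :=
  if r < m ∨ m = 0 then (if r = j then 1 else 0)
  else Polynomial.C (1 / mu) *
    ((Polynomial.X + Polynomial.C (if r - m < m then lam else lam + mu)) * q m lam mu j (r - m) -
      (if r = m then 0 else Polynomial.C lam * q m lam mu j (r - m - 1)))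
termination_by r
decreasing_by all_goals omega

/-- The complex vector space of functions `ℂ → ℂ` that are smooth in the real sense,
i.e. `C^∞(ℝ²)` with complex values. -/
def smoothFunctions : Submodule ℂ (ℂ → ℂ) where
  carrier := {f | ContDiff ℝ ∞ f}
  add_mem' hf hg := by
    rw [Set.mem_ofPred_eq] at hf hg ⊢
    exact hf.add hg
  zero_mem' := by
    rw [Set.mem_ofPred_eq]
    exact contDiff_const
  smul_mem' c _ hf := by
    rw [Set.mem_ofPred_eq] at hf ⊢
    exact contDiff_const.smul hf

/-- A distribution with compact support on the plane `ℂ = ℝ²`: a linear functional on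
`C^∞(ℂ)` which is continuous, that is, bounded by finitely many derivatives on a compact set. -/
structure CompactDistribution where
  toLinearMap : smoothFunctions →ₗ[ℂ] ℂ
  bounded : ∃ (K : Set ℂ) (N : ℕ) (C : ℝ), IsCompact K ∧
    ∀ (f : smoothFunctions) (B : ℝ), 0 ≤ B →
      (∀ k ≤ N, ∀ x ∈ K, ‖iteratedFDeriv ℝ k (f : ℂ → ℂ) x‖ ≤ B) →
      ‖toLinearMap f‖ ≤ C * B

/-- The function `x ↦ e^{xt} Q_n(x) q_{j,r}(x)`. -/
def kernelFun (m : ℕ) (lam mu : ℝ) (n r j : ℕ) (t : ℂ) (x : ℂ) : ℂ :=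
  Complex.exp (x * t) * Polynomial.aeval x (Q m lam mu n) * Polynomial.aeval x (q m lam mu j r)

theorem kernelFun_mem (m : ℕ) (lam mu : ℝ) (n r j : ℕ) (t : ℂ) :
    kernelFun m lam mu n r j t ∈ smoothFunctions := by
  have h : Differentiable ℂ (kernelFun m lam mu n r j t) :=
    (((differentiable_id.mul_const t).cexp).mul (Polynomial.differentiable_aeval _)).mul
      (Polynomial.differentiable_aeval _)
  exact (h.contDiff (n := ∞)).restrict_scalars ℝ

/-- `P_{n,r}(t) = ∫ e^{xt} Q_n(x) ∑_{j<m} q_{j,r}(x) dσ_j(x)`, for complex `t`. -/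
def P (m : ℕ) (lam mu : ℝ) (σ : Fin m → CompactDistribution) (n r : ℕ) (t : ℂ) : ℂ :=
  ∑ j : Fin m, (σ j).toLinearMap ⟨kernelFun m lam mu n r j t, kernelFun_mem m lam mu n r j t⟩

/-- The function `x ↦ Q_n(x) q_{j,r}(x)`. -/
def productFun (m : ℕ) (lam mu : ℝ) (n r j : ℕ) (x : ℂ) : ℂ :=
  Polynomial.aeval x (Q m lam mu n) * Polynomial.aeval x (q m lam mu j r)

theorem productFun_mem (m : ℕ) (lam mu : ℝ) (n r j : ℕ) :
    productFun m lam mu n r j ∈ smoothFunctions := by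
  have h : Differentiable ℂ (productFun m lam mu n r j) :=
    (Polynomial.differentiable_aeval _).mul (Polynomial.differentiable_aeval _)
  exact (h.contDiff (n := ∞)).restrict_scalars ℝ

/-- The bi-orthogonality relations `∫ Q_n(x) ∑_{j<m} q_{j,r}(x) dσ_j(x) = δ_{n,r}`. -/
def IsBiorthogonal (m : ℕ) (lam mu : ℝ) (σ : Fin m → CompactDistribution) : Prop :=
  ∀ n r : ℕ, ∑ j : Fin m,
    (σ j).toLinearMap ⟨productFun m lam mu n r j, productFun_mem m lam mu n r j⟩ =
      if n = r then 1 else 0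

/-- `R` solves `R' = A R` on `[0, ∞)` entrywise (one-sided derivative at `0`), `R(0) = I`.
The series is a finite sum, as every row of `A` has at most three nonzero entries. -/
structure IsSolution (m : ℕ) (lam mu : ℝ) (R : ℕ → ℕ → ℝ → ℂ) : Prop where
  hasDeriv : ∀ (n r : ℕ) (t : ℝ), 0 ≤ t →
    HasDerivWithinAt (R n r) (∑' k : ℕ, (generator m lam mu n k : ℂ) * R k r t) (Set.Ici 0) t
  initial : ∀ n r : ℕ, R n r 0 = if n = r then 1 else 0

/-- (Honest, standard) transition probability functions on `{0, 1, 2, …}`. -/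
structure IsTransitionFunction (p : ℕ → ℕ → ℝ → ℝ) : Prop where
  nonneg : ∀ (i j : ℕ) (t : ℝ), 0 ≤ t → 0 ≤ p i j t
  initial : ∀ i j : ℕ, p i j 0 = if i = j then 1 else 0
  honest : ∀ (i : ℕ) (t : ℝ), 0 ≤ t → HasSum (fun j => p i j t) 1
  semigroup : ∀ (i j : ℕ) (s t : ℝ), 0 ≤ s → 0 ≤ t →
    HasSum (fun k => p i k s * p k j t) (p i j (s + t))
  tendsto : ∀ i j : ℕ, Tendsto (p i j) (𝓝[>] 0) (𝓝 (if i = j then 1 else 0))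

end BulkQueue

end

/-! The matrix `A` is a bounded operator on bounded sequences, and the theorem reduces to the
identity `P n r t = (exp (tA))_{n,r}`, whose right-hand side does not involve `σ`
(`IsBiorthogonal.P_eq_expOp`).

The recurrence for `Q` says that the column `(Q_n(x))_n` is a formal eigenvector of `A` with
eigenvalue `x`. Under the integral a factor `x` therefore acts as `A` from the left, and
biorthogonality gives `∫ x^k Q_n ∑_j q_{j,r} dσ_j = (A^k)_{n,r}`. The exponential may be expanded
inside the integral because, by Cauchy's estimates, a compactly supported distribution is continuous
on entire functions for uniform convergence on a large disc.

For existence, `Q_n(A)` has zeroth row `e_n` and `∑_j q_{j,r}(A) e_j = e_r`. Hence it suffices that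
`σ_j` has moments `(A^k e_j)_0`. These grow geometrically, so a density on a circle realises them.

The transition properties come from `A = J - (λ+μ)I` with `J` entrywise nonnegative
(uniformization), from `A 1 = 0`, and from the group law together with the fact that `exp (tA)` acts
through its matrix. Uniqueness for entire entries compares Taylor coefficients at `0`; for
transition functions it iterates an integral estimate on a bounded difference. -/

noncomputable section

namespace BulkQueue

/-! ### Compactly supported distributions on entire functions -/

/-- On entire functions a compactly supported distribution is bounded by the supremum over a
disc, by Cauchy's estimates. -/
theorem CompactDistribution.exists_bound_of_entire (T : CompactDistribution) :
    ∃ R C : ℝ, ∀ f : smoothFunctions, Differentiable ℂ (f : ℂ → ℂ) → ∀ B : ℝ, 0 ≤ B →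
      (∀ x, ‖x‖ ≤ R → ‖(f : ℂ → ℂ) x‖ ≤ B) → ‖T.toLinearMap f‖ ≤ C * B := by
  obtain ⟨K, N, C, hK, hT⟩ := T.bounded
  obtain ⟨R, hR⟩ := hK.isBounded.subset_closedBall 0
  -- Cauchy's estimates on unit circles centred in `K` cost a factor `k! ≤ N!`; these circles stay
  -- in the disc of radius `R + 1`.
  refine ⟨R + 1, C * N.factorial, fun f hf B hB hfB => ?_⟩
  rw [mul_assoc]
  refine hT f _ (by positivity) fun k hk x hx => ?_
  have hxR : ‖x‖ ≤ R := by simpa using hR hx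
  have hc : ContDiffAt ℂ k (f : ℂ → ℂ) x := hf.contDiff.contDiffAt
  have h1 : ‖iteratedFDeriv ℝ k (f : ℂ → ℂ) x‖ = ‖iteratedDeriv k (f : ℂ → ℂ) x‖ := by
    rw [← hc.restrictScalars_iteratedFDeriv (𝕜 := ℝ), ← norm_iteratedFDeriv_eq_norm_iteratedDeriv]
    rfl
  rw [h1]
  have h2 := Complex.norm_iteratedDeriv_le_of_forall_mem_sphere_norm_le (c := x) (R := 1) (C := B)
    k one_pos hf.diffContOnCl (fun z hz => hfB z (by
      have h3 : ‖z - x‖ = 1 := by simpa [dist_eq_norm] using hz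
      have := norm_add_le (z - x) x
      rw [sub_add_cancel] at this
      linarith))
  rw [one_pow, div_one] at h2
  refine h2.trans (mul_le_mul_of_nonneg_right ?_ hB)
  exact_mod_cast Nat.factorial_le hk

theorem mem_smoothFunctions_of_differentiable {f : ℂ → ℂ} (hf : Differentiable ℂ f) :
    f ∈ smoothFunctions :=
  (hf.contDiff (n := ∞)).restrict_scalars ℝ

/-- A compactly supported distribution may be applied to `e^{xt} g(x)` termwise. -/
theorem CompactDistribution.tendsto_exp_series (T : CompactDistribution) {g : ℂ → ℂ}
    (hg : Differentiable ℂ g) (t : ℂ) :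
    Tendsto (fun N : ℕ => ∑ k ∈ Finset.range N, ((k.factorial : ℂ)⁻¹ * t ^ k) *
        T.toLinearMap ⟨fun x => x ^ k * g x,
          mem_smoothFunctions_of_differentiable ((differentiable_id.pow k).mul hg)⟩) atTop
      (𝓝 (T.toLinearMap ⟨fun x => Complex.exp (x * t) * g x,
        mem_smoothFunctions_of_differentiable ((differentiable_id.mul_const t).cexp.mul hg)⟩)) := by
  obtain ⟨R, C, hT⟩ := T.exists_bound_of_entire
  obtain ⟨G, hG⟩ := (isCompact_closedBall (0 : ℂ) R).exists_bound_of_continuousOn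
    hg.continuous.continuousOn
  have hu : Summable fun k : ℕ => (|R| * ‖t‖) ^ k / k.factorial * |G| :=
    (Real.summable_pow_div_factorial _).mul_right _
  have hunif := tendstoUniformlyOn_tsum_nat (s := Metric.closedBall (0 : ℂ) R)
    (f := fun k x => ((k.factorial : ℂ)⁻¹ * t ^ k) * (x ^ k * g x)) hu (fun k x hx => by
      have hxR : ‖x‖ ≤ |R| := (by simpa using hx : ‖x‖ ≤ R).trans (le_abs_self R)
      have hGx : ‖g x‖ ≤ |G| := (hG x hx).trans (le_abs_self G)
      rw [norm_mul, norm_mul, norm_mul, norm_inv, norm_pow, norm_pow, Complex.norm_natCast,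
        mul_pow]
      calc _ = ‖x‖ ^ k * ‖t‖ ^ k / k.factorial * ‖g x‖ := by ring
        _ ≤ _ := by gcongr)
  have hsum : ∀ x : ℂ, ∑' k : ℕ, ((k.factorial : ℂ)⁻¹ * t ^ k) * (x ^ k * g x)
      = Complex.exp (x * t) * g x := by
    intro x
    have h := (NormedSpace.expSeries_div_hasSum_exp (x * t)).mul_right (g x)
    rw [← Complex.exp_eq_exp_ℂ] at h
    rw [← h.tsum_eq]
    congr 1; ext k; rw [mul_pow]; ring
  simp only [hsum] at hunif
  rw [Metric.tendstoUniformlyOn_iff] at hunif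
  rw [Metric.tendsto_atTop]
  intro ε hε
  have hδ : 0 < ε / (|C| + 1) := by positivity
  obtain ⟨N₀, hN₀⟩ := eventually_atTop.1 (hunif _ hδ)
  refine ⟨N₀, fun N hN => ?_⟩
  rw [dist_comm, dist_eq_norm]
  have hlin : ∀ F : smoothFunctions, T.toLinearMap F - ∑ k ∈ Finset.range N,
      ((k.factorial : ℂ)⁻¹ * t ^ k) * T.toLinearMap ⟨fun x => x ^ k * g x,
          mem_smoothFunctions_of_differentiable ((differentiable_id.pow k).mul hg)⟩
      = T.toLinearMap (F - ∑ k ∈ Finset.range N, ((k.factorial : ℂ)⁻¹ * t ^ k) •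
        (⟨fun x => x ^ k * g x,
          mem_smoothFunctions_of_differentiable ((differentiable_id.pow k).mul hg)⟩ :
          smoothFunctions)) := by
    intro F
    simp only [map_sub, map_sum, map_smul, smul_eq_mul]
  rw [hlin]
  generalize hD : (_ - Finset.sum (Finset.range N) _ : smoothFunctions) = D
  have hDf : (D : ℂ → ℂ) = fun x => Complex.exp (x * t) * g x -
      ∑ k ∈ Finset.range N, ((k.factorial : ℂ)⁻¹ * t ^ k) * (x ^ k * g x) := by
    ext x
    simp [← hD, Finset.sum_apply]
  have h := hT D (by
    rw [hDf]
    refine ((differentiable_id.mul_const t).cexp.mul hg).sub ?_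
    exact Differentiable.fun_sum fun k _ => ((differentiable_id.pow k).mul hg).const_mul _)
    _ hδ.le (fun x hx => by
      have := (hN₀ N hN x (by simpa using hx)).le
      rw [dist_eq_norm] at this
      rw [hDf]; exact this)
  refine h.trans_lt ?_
  calc C * (ε / (|C| + 1)) ≤ |C| * (ε / (|C| + 1)) := by gcongr; exact le_abs_self C
    _ < (|C| + 1) * (ε / (|C| + 1)) := by gcongr; linarith
    _ = ε := by field_simp

/-- Every sequence of geometric growth is the moment sequence of a complex measure on a circle. -/
theorem exists_compactDistribution_moments (a : ℕ → ℂ) (ρ : ℝ) (hρ : 0 ≤ ρ)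
    (C : ℝ) (ha : ∀ k, ‖a k‖ ≤ C * ρ ^ k) :
    ∃ T : CompactDistribution, ∀ k : ℕ, T.toLinearMap ⟨fun x => x ^ k,
      mem_smoothFunctions_of_differentiable (differentiable_id.pow k)⟩ = a k := by
  -- A radius strictly above `ρ` makes the series for the density below converge uniformly on the
  -- circle.
  set R : ℝ := ρ + 1 with hRdef
  have hR : 0 < R := by positivity
  have hz0 : ∀ z ∈ Metric.sphere (0 : ℂ) R, z ≠ 0 := by
    rintro z hz rfl
    simp [hR.ne] at hz
  set u : ℕ → ℝ := fun k => C * (ρ / R) ^ k * R⁻¹ with hu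
  have hsu : Summable u := by
    refine ((summable_geometric_of_lt_one (by positivity) ?_).mul_left C).mul_right _
    rw [div_lt_one hR]; linarith
  have hb : ∀ k : ℕ, ∀ z ∈ Metric.sphere (0 : ℂ) R, ‖a k * (z ^ (k + 1))⁻¹‖ ≤ u k := by
    intro k z hz
    have hzR : ‖z‖ = R := by simpa using hz
    rw [norm_mul, norm_inv, norm_pow, hzR]
    calc ‖a k‖ * (R ^ (k + 1))⁻¹ ≤ C * ρ ^ k * (R ^ (k + 1))⁻¹ := by gcongr; exact ha k
      _ = u k := by simp only [hu]; rw [div_pow, pow_succ]; field_simp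
  -- In `z ^ n * g z` the coefficient of `z⁻¹` is `a n`, so integration over the circle picks out
  -- this moment.
  set g : ℂ → ℂ := fun z => ∑' k : ℕ, a k * (z ^ (k + 1))⁻¹ with hg
  have hcont : ∀ k : ℕ, ContinuousOn (fun z : ℂ => a k * (z ^ (k + 1))⁻¹)
      (Metric.sphere (0 : ℂ) R) := fun k =>
    continuousOn_const.mul ((continuousOn_id.pow _).inv₀ fun z hz => pow_ne_zero _ (hz0 z hz))
  have hgc : ContinuousOn g (Metric.sphere (0 : ℂ) R) :=
    continuousOn_tsum hcont hsu hb
  have hint : ∀ f : ℂ → ℂ, Continuous f → CircleIntegrable (fun z => f z * g z) 0 R :=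
    fun f hf => (hf.continuousOn.mul hgc).circleIntegrable hR.le
  have hsm : ∀ f : smoothFunctions, Continuous (f : ℂ → ℂ) := fun f => by
    have h : ContDiff ℝ ∞ (f : ℂ → ℂ) := f.2
    exact h.continuous
  have hpi : (2 * Real.pi * Complex.I : ℂ) ≠ 0 := Complex.two_pi_I_ne_zero
  obtain ⟨G, hG⟩ := (isCompact_sphere (0 : ℂ) R).exists_bound_of_continuousOn hgc
  refine ⟨⟨{ toFun := fun f => (2 * Real.pi * Complex.I : ℂ)⁻¹ • ∮ z in C(0, R), (f : ℂ → ℂ) z * g z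
             map_add' := ?_
             map_smul' := ?_ }, Metric.sphere 0 R, 0, R * |G|, isCompact_sphere 0 R, ?_⟩, ?_⟩
  · intro f h
    simp only [Submodule.coe_add, Pi.add_apply, add_mul]
    rw [circleIntegral.integral_add (hint _ (hsm f)) (hint _ (hsm h)), smul_add]
  · intro c f
    simp only [Submodule.coe_smul, Pi.smul_apply, smul_eq_mul, mul_assoc, RingHom.id_apply]
    rw [circleIntegral.integral_const_mul]
    ring
  · intro f B hB hf
    have := circleIntegral.norm_two_pi_i_inv_smul_integral_le_of_norm_le_const (c := 0)
      (f := fun z => (f : ℂ → ℂ) z * g z) (C := B * |G|) hR.le (fun z hz => by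
        rw [norm_mul]
        have h0 := hf 0 le_rfl z hz
        rw [norm_iteratedFDeriv_zero] at h0
        gcongr
        exact (hG z hz).trans (le_abs_self G))
    refine this.trans (le_of_eq (by ring))
  · intro n
    have hunif : TendstoUniformlyOn (fun (N : ℕ) (z : ℂ) =>
        ∑ k ∈ Finset.range N, z ^ n * (a k * (z ^ (k + 1))⁻¹)) (fun z => z ^ n * g z) atTop
        (Metric.sphere 0 R) := by
      simp only [hg, ← tsum_mul_left]
      refine tendstoUniformlyOn_tsum_nat (hsu.mul_left (R ^ n)) fun k z hz => ?_
      have hzR : ‖z‖ = R := by simpa using hz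
      rw [norm_mul, norm_pow, hzR]
      gcongr
      exact hb k z hz
    have hct : ∀ k : ℕ, ContinuousOn (fun z : ℂ => z ^ n * (a k * (z ^ (k + 1))⁻¹))
        (Metric.sphere (0 : ℂ) R) := fun k => (continuousOn_id.pow n).mul (hcont k)
    have hlim := hunif.tendsto_circleIntegral_of_continuousOn hR.le
      (Eventually.of_forall fun N => continuousOn_finsetSum _ fun k _ => hct k)
    have hterm : ∀ k : ℕ, (∮ z in C(0, R), z ^ n * (a k * (z ^ (k + 1))⁻¹)) =
        if k = n then 2 * Real.pi * Complex.I * a n else 0 := by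
      intro k
      have h1 : (∮ z in C(0, R), z ^ n * (a k * (z ^ (k + 1))⁻¹)) =
          ∮ z in C(0, R), a k * (z - 0) ^ ((n : ℤ) - (k + 1)) := by
        refine circleIntegral.integral_congr hR.le fun z hz => ?_
        have := hz0 z hz
        simp only [sub_zero]
        rw [zpow_sub₀ this]
        have h3 : z ^ ((k : ℤ) + 1) = z ^ (k + 1) := by exact_mod_cast zpow_natCast z (k + 1)
        rw [h3, zpow_natCast]
        ring
      rw [h1, circleIntegral.integral_const_mul]
      split_ifs with h
      · subst h
        have h4 : ((k : ℤ) - (k + 1)) = -1 := by ring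
        simp only [h4, zpow_neg_one]
        rw [circleIntegral.integral_sub_center_inv 0 hR.ne', mul_comm]
      · rw [circleIntegral.integral_sub_zpow_of_ne (by omega), mul_zero]
    have hconst : ∀ᶠ N : ℕ in atTop, (∮ z in C(0, R), ∑ k ∈ Finset.range N,
        z ^ n * (a k * (z ^ (k + 1))⁻¹)) = 2 * Real.pi * Complex.I * a n := by
      filter_upwards [eventually_gt_atTop n] with N hN
      rw [circleIntegral.integral_fun_sum fun k _ => (hct k).circleIntegrable hR.le,
        Finset.sum_congr rfl fun k _ => hterm k]
      simp [hN]
    have := tendsto_nhds_unique hlim (tendsto_const_nhds.congr' (hconst.mono fun _ h => h.symm))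
    simp only [LinearMap.coe_mk, AddHom.coe_mk, this, smul_eq_mul]
    field_simp

/-! ### Exponentials of bounded operators -/

section ExpOp

variable {E : Type*} [NormedAddCommGroup E] [NormedSpace ℂ E]

/-- The group `z ↦ exp (z B)` generated by a bounded operator. -/
def expOp (B : E →L[ℂ] E) (z : ℂ) : E →L[ℂ] E := NormedSpace.exp (z • B)

theorem expOp_zero (B : E →L[ℂ] E) : expOp B 0 = 1 := by
  rw [expOp, zero_smul, NormedSpace.exp_zero]

theorem pow_succ_apply (B : E →L[ℂ] E) (k : ℕ) (v : E) : (B ^ (k + 1)) v = B ((B ^ k) v) := by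
  rw [pow_succ']; rfl

theorem pow_succ_apply' (B : E →L[ℂ] E) (k : ℕ) (v : E) : (B ^ (k + 1)) v = (B ^ k) (B v) := by
  rw [pow_succ]; rfl

theorem norm_pow_apply_le (B : E →L[ℂ] E) (k : ℕ) (v : E) : ‖(B ^ k) v‖ ≤ ‖B‖ ^ k * ‖v‖ := by
  induction k with
  | zero => simp
  | succ k ih =>
    rw [pow_succ_apply, pow_succ', mul_assoc]
    exact (B.le_opNorm _).trans (by gcongr)

variable [CompleteSpace E]

theorem expOp_add (B : E →L[ℂ] E) (s t : ℂ) (v : E) :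
    expOp B (s + t) v = expOp B s (expOp B t v) := by
  let _ : NormedAlgebra ℚ (E →L[ℂ] E) := NormedAlgebra.restrictScalars ℚ ℂ _
  rw [expOp, add_smul,
    NormedSpace.exp_add_of_commute (((Commute.refl B).smul_left s).smul_right t)]
  rfl

theorem hasSum_expOp_apply (B : E →L[ℂ] E) (z : ℂ) (v : E) :
    HasSum (fun k : ℕ => ((k.factorial : ℂ)⁻¹ * z ^ k) • (B ^ k) v) (expOp B z v) := by
  have h := NormedSpace.exp_series_hasSum_exp' (𝕂 := ℂ) (z • B)
  have h2 := h.mapL (ContinuousLinearMap.apply ℂ E v)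
  refine h2.congr_fun fun k => ?_
  rw [smul_pow, smul_smul]
  rfl

theorem hasDerivAt_expOp_apply (B : E →L[ℂ] E) (v : E) (z : ℂ) :
    HasDerivAt (fun z => expOp B z v) (B (expOp B z v)) z :=
  (ContinuousLinearMap.apply ℂ E v).hasFDerivAt.comp_hasDerivAt z
    (hasDerivAt_exp_smul_const' (𝕂 := ℂ) B z)

theorem expOp_sub_smul_one (B : E →L[ℂ] E) (c z : ℂ) (v : E) :
    expOp (B - c • 1) z v = Complex.exp (-(z * c)) • expOp B z v := by
  let _ : NormedAlgebra ℚ (E →L[ℂ] E) := NormedAlgebra.restrictScalars ℚ ℂ _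
  have h1 : z • (B - c • 1) = algebraMap ℂ (E →L[ℂ] E) (-(z * c)) + z • B := by
    rw [Algebra.algebraMap_eq_smul_one, smul_sub, smul_smul, neg_smul]
    abel
  rw [expOp, h1, NormedSpace.exp_add_of_commute (Algebra.commutes _ _),
    ← NormedSpace.algebraMap_exp_comm, ← Complex.exp_eq_exp_ℂ, Algebra.algebraMap_eq_smul_one]
  rfl

theorem expOp_apply_of_apply_eq_zero {B : E →L[ℂ] E} {v : E} (h : B v = 0) (z : ℂ) :
    expOp B z v = v := by
  refine (hasSum_expOp_apply B z v).unique ?_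
  convert hasSum_single 0 fun k hk => ?_ using 1
  · simp
  · obtain ⟨k, rfl⟩ := Nat.exists_eq_succ_of_ne_zero hk
    rw [pow_succ_apply', h, map_zero, smul_zero]

end ExpOp

/-! ### The generator on bounded sequences -/

open BoundedContinuousFunction

/-- The state reached from `n` by a service event; in states below `m` nothing happens. -/
def serve (m n : ℕ) : ℕ := if n < m then n else n - m

/-- The nonnegative operator `v ↦ λ v(n+1) + μ v(serve n)` on bounded sequences. -/
def jumpOp (m : ℕ) (lam mu : ℝ) : (ℕ →ᵇ ℂ) →L[ℂ] (ℕ →ᵇ ℂ) :=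
  (lam : ℂ) • compContinuousCLM ℂ ℂ ⟨Nat.succ, continuous_of_discreteTopology⟩ +
    (mu : ℂ) • compContinuousCLM ℂ ℂ ⟨serve m, continuous_of_discreteTopology⟩

/-- The generator as a bounded operator on bounded sequences. -/
def genOp (m : ℕ) (lam mu : ℝ) : (ℕ →ᵇ ℂ) →L[ℂ] (ℕ →ᵇ ℂ) :=
  jumpOp m lam mu - ((lam + mu : ℝ) : ℂ) • 1

/-- The indicator sequence of `{r}`. -/
def unitSeq (r : ℕ) : ℕ →ᵇ ℂ :=
  ofNormedAddCommGroupDiscrete (fun n => if n = r then 1 else 0) 1 fun n => by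
    split_ifs <;> simp

theorem unitSeq_apply (r n : ℕ) : unitSeq r n = if n = r then 1 else 0 := rfl

theorem jumpOp_apply (m : ℕ) (lam mu : ℝ) (v : ℕ →ᵇ ℂ) (n : ℕ) :
    jumpOp m lam mu v n = lam * v (n + 1) + mu * v (serve m n) := rfl

theorem genOp_apply (m : ℕ) (lam mu : ℝ) (v : ℕ →ᵇ ℂ) (n : ℕ) :
    genOp m lam mu v n = lam * v (n + 1) + mu * v (serve m n) - (lam + mu) * v n := by
  have : genOp m lam mu v n = jumpOp m lam mu v n - ((lam + mu : ℝ) : ℂ) * v n := rfl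
  rw [this, jumpOp_apply]; push_cast; rfl

/-- Below `m`, where `serve m n = n`, the diagonal entry `-λ` appears as `μ - (λ + μ)`; this gives
one formula for all rows. -/
theorem hasSum_generator_mul (m : ℕ) (hm : 1 ≤ m) (lam mu : ℝ) (v : ℕ → ℂ) (n : ℕ) :
    HasSum (fun k => (generator m lam mu n k : ℂ) * v k)
      (lam * v (n + 1) + mu * v (serve m n) - (lam + mu) * v n) := by
  have h1 := hasSum_ite_eq (n + 1) ((lam : ℂ) * v (n + 1))
  have h2 := hasSum_ite_eq (serve m n) ((mu : ℂ) * v (serve m n))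
  have h3 := hasSum_ite_eq n (((lam : ℂ) + mu) * v n)
  refine ((h1.add h2).sub h3).congr_fun fun k => ?_
  unfold generator serve
  by_cases hn : n < m
  · by_cases hk1 : k = n + 1
    · subst hk1; simp [hn]
    · by_cases hk2 : k = n
      · subst hk2; simp [hn]; ring
      · have : n ≠ k + m := by omega
        simp [hn, hk1, hk2, this]
  · by_cases hk1 : k = n + 1
    · subst hk1
      have : n + 1 ≠ n - m := by omega
      simp [hn, this]
    · by_cases hk2 : k = n
      · subst hk2
        have : k ≠ k - m := by omega
        simp [hn, this]
        ring
      · by_cases hk3 : n = k + m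
        · subst hk3
          have : k + m - m = k := by omega
          have hm0 : m ≠ 0 := by omega
          simp [this, hk1, hm0]
        · have : k ≠ n - m := by omega
          simp [hn, hk1, hk2, hk3, this]

theorem tsum_generator_mul (m : ℕ) (hm : 1 ≤ m) (lam mu : ℝ) (v : ℕ → ℂ) (n : ℕ) :
    ∑' k, (generator m lam mu n k : ℂ) * v k =
      lam * v (n + 1) + mu * v (serve m n) - (lam + mu) * v n :=
  (hasSum_generator_mul m hm lam mu v n).tsum_eq

theorem hasSum_expOp_apply_apply (B : (ℕ →ᵇ ℂ) →L[ℂ] (ℕ →ᵇ ℂ)) (z : ℂ) (v : ℕ →ᵇ ℂ) (n : ℕ) :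
    HasSum (fun k : ℕ => ((k.factorial : ℂ)⁻¹ * z ^ k) * ((B ^ k) v) n) (expOp B z v n) :=
  (hasSum_expOp_apply B z v).mapL (evalCLM ℂ n)

/-! ### The semigroup and its matrix -/

section Semigroup

variable (m : ℕ) (lam mu : ℝ)

theorem hasDerivAt_expOp_genOp_apply (v : ℕ →ᵇ ℂ) (n : ℕ) (z : ℂ) :
    HasDerivAt (fun z => expOp (genOp m lam mu) z v n)
      (genOp m lam mu (expOp (genOp m lam mu) z v) n) z :=
  (evalCLM ℂ n : (ℕ →ᵇ ℂ) →L[ℂ] ℂ).hasFDerivAt.comp_hasDerivAt z (hasDerivAt_expOp_apply (genOp m lam mu) v z)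

/-- Each entry of `A v` involves only finitely many entries of `v`, so powers of `A` respect
pointwise limits. -/
theorem genOp_pow_tendsto {u : Finset ℕ → ℕ →ᵇ ℂ} {v : ℕ →ᵇ ℂ}
    (h : ∀ n, Tendsto (fun s => u s n) atTop (𝓝 (v n))) (k n : ℕ) :
    Tendsto (fun s => (genOp m lam mu ^ k) (u s) n) atTop (𝓝 ((genOp m lam mu ^ k) v n)) := by
  induction k generalizing n with
  | zero => simpa using h n
  | succ k ih =>
    simp only [pow_succ_apply, genOp_apply]
    exact (((ih _).const_mul _).add ((ih _).const_mul _)).sub ((ih _).const_mul _)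

/-- Dominated convergence in the exponential series, using the uniform bound `K`. -/
theorem expOp_genOp_tendsto {u : Finset ℕ → ℕ →ᵇ ℂ} {v : ℕ →ᵇ ℂ} {K : ℝ}
    (hK : ∀ s, ‖u s‖ ≤ K) (h : ∀ n, Tendsto (fun s => u s n) atTop (𝓝 (v n))) (z : ℂ) (n : ℕ) :
    Tendsto (fun s => expOp (genOp m lam mu) z (u s) n) atTop
      (𝓝 (expOp (genOp m lam mu) z v n)) := by
  simp only [← (hasSum_expOp_apply_apply (genOp m lam mu) z _ n).tsum_eq]
  refine tendsto_tsum_of_dominated_convergence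
    (bound := fun k => (‖z‖ * ‖genOp m lam mu‖) ^ k / k.factorial * K)
    ((Real.summable_pow_div_factorial _).mul_right _)
    (fun k => (genOp_pow_tendsto m lam mu h k n).const_mul _)
    (Eventually.of_forall fun s k => ?_)
  rw [norm_mul, norm_mul, norm_inv, norm_pow, Complex.norm_natCast]
  have h1 : ‖(genOp m lam mu ^ k) (u s) n‖ ≤ ‖genOp m lam mu‖ ^ k * K := by
    refine (norm_coe_le_norm _ n).trans ((norm_pow_apply_le _ _ _).trans ?_)
    gcongr
    exact hK s
  calc _ ≤ (k.factorial : ℝ)⁻¹ * ‖z‖ ^ k * (‖genOp m lam mu‖ ^ k * K) := by gcongr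
    _ = _ := by rw [mul_pow]; ring

/-- The operators `exp (z A)` on bounded sequences are given by their matrices. -/
theorem hasSum_expOp_genOp_mul (z : ℂ) (v : ℕ →ᵇ ℂ) (n : ℕ) :
    HasSum (fun k => expOp (genOp m lam mu) z (unitSeq k) n * v k)
      (expOp (genOp m lam mu) z v n) := by
  have hval : ∀ (s : Finset ℕ) (i : ℕ),
      (∑ k ∈ s, v k • unitSeq k) i = if i ∈ s then v i else 0 := by
    intro s i
    simp [BoundedContinuousFunction.coe_sum, Finset.sum_apply, unitSeq_apply]
  -- Finite truncations of `v` need not converge to `v` in norm, only pointwise and boundedly, so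
  -- continuity of the operator alone would not suffice.
  have h := expOp_genOp_tendsto m lam mu (u := fun s => ∑ k ∈ s, v k • unitSeq k) (v := v)
    (K := ‖v‖) (fun s => (norm_le (norm_nonneg v)).2 fun i => by
      rw [hval]; split_ifs
      · exact norm_coe_le_norm v i
      · simp) (fun i => by
      simp only [hval]
      refine tendsto_const_nhds.congr' ?_
      filter_upwards [eventually_ge_atTop {i}] with s hs
      rw [if_pos (hs (Finset.mem_singleton_self i))]) z n
  refine h.congr fun s => ?_
  simp [map_sum, BoundedContinuousFunction.coe_sum, Finset.sum_apply, mul_comm]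

theorem expOp_genOp_one (z : ℂ) : expOp (genOp m lam mu) z 1 = 1 := by
  refine expOp_apply_of_apply_eq_zero ?_ z
  ext n
  simp [genOp_apply]

-- Uniformization: `exp (tA) = e^{-(λ+μ)t} exp (tJ)`, and all terms of the series for `exp (tJ)`
-- preserve nonnegativity.
open ComplexOrder in
theorem expOp_genOp_nonneg (hlam : 0 ≤ lam) (hmu : 0 ≤ mu) {t : ℝ} (ht : 0 ≤ t) {v : ℕ →ᵇ ℂ}
    (hv : ∀ n, 0 ≤ v n) (n : ℕ) : 0 ≤ expOp (genOp m lam mu) t v n := by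
  have hpow : ∀ k n, 0 ≤ (jumpOp m lam mu ^ k) v n := by
    intro k
    induction k with
    | zero => simpa using hv
    | succ k ih =>
      intro n
      rw [pow_succ_apply, jumpOp_apply]
      have h1 : (0 : ℂ) ≤ lam := by exact_mod_cast hlam
      have h2 : (0 : ℂ) ≤ mu := by exact_mod_cast hmu
      exact add_nonneg (mul_nonneg h1 (ih _)) (mul_nonneg h2 (ih _))
  have hsplit : expOp (genOp m lam mu) t v n =
      ((Real.exp (-(t * (lam + mu))) : ℝ) : ℂ) * expOp (jumpOp m lam mu) t v n := by
    rw [genOp, expOp_sub_smul_one]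
    push_cast
    rfl
  rw [hsplit]
  have h2 : (0 : ℂ) ≤ ((Real.exp (-(t * (lam + mu))) : ℝ) : ℂ) := by
    exact_mod_cast (Real.exp_pos _).le
  refine mul_nonneg h2 (HasSum.nonneg (fun k => ?_) (hasSum_expOp_apply_apply _ _ v n))
  refine mul_nonneg ?_ (hpow k n)
  have : (0 : ℂ) ≤ (((k.factorial : ℝ)⁻¹ * t ^ k : ℝ) : ℂ) := by
    rw [Complex.zero_le_real]
    positivity
  simpa using this

end Semigroup

theorem serve_le (m n : ℕ) : serve m n ≤ n := by
  unfold serve; split_ifs <;> omega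

/-! ### The polynomials evaluated at the generator -/

section Polynomials

variable (m : ℕ) (lam mu : ℝ)

/-- Both cases of the recurrence merge: for `n < m` the term `μ Q_{serve n} = μ Q_n` cancels the
extra `μ`. -/
theorem C_mul_Q_succ (hlam : lam ≠ 0) (n : ℕ) :
    Polynomial.C lam * Q m lam mu (n + 1) =
      Q m lam mu n * (Polynomial.X + Polynomial.C (lam + mu)) -
        Polynomial.C mu * Q m lam mu (serve m n) := by
  have hC : Polynomial.C lam * Polynomial.C (1 / lam) = 1 := by
    rw [← Polynomial.C_mul, mul_one_div_cancel hlam, Polynomial.C_1]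
  rw [Q, serve]
  split_ifs with h
  · rw [← mul_assoc, hC, Polynomial.C_add]; ring
  · rw [← mul_assoc, hC]; ring

theorem mul_aeval_Q (hlam : lam ≠ 0) (n : ℕ) (x : ℂ) :
    x * Polynomial.aeval x (Q m lam mu n) = lam * Polynomial.aeval x (Q m lam mu (n + 1)) +
      mu * Polynomial.aeval x (Q m lam mu (serve m n)) -
      (lam + mu) * Polynomial.aeval x (Q m lam mu n) := by
  have h := congrArg (Polynomial.aeval x) (C_mul_Q_succ m lam mu hlam n)
  simp only [map_mul, map_sub, map_add, Polynomial.aeval_C, Polynomial.aeval_X,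
    Complex.coe_algebraMap] at h
  linear_combination -h

theorem q_of_lt {j r : ℕ} (h : r < m) : q m lam mu j r = if r = j then 1 else 0 := by
  rw [q, if_pos (Or.inl h)]

theorem C_mul_q_add (hm : 1 ≤ m) (hmu : mu ≠ 0) (j s : ℕ) :
    Polynomial.C mu * q m lam mu j (s + m) =
      (Polynomial.X + Polynomial.C (if s < m then lam else lam + mu)) * q m lam mu j s -
        if s = 0 then 0 else Polynomial.C lam * q m lam mu j (s - 1) := by
  have hC : Polynomial.C mu * Polynomial.C (1 / mu) = 1 := by
    rw [← Polynomial.C_mul, mul_one_div_cancel hmu, Polynomial.C_1]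
  rw [q, if_neg (by omega), ← mul_assoc, hC, one_mul, Nat.add_sub_cancel]
  simp only [Nat.add_eq_right]

variable {E : Type*} [NormedAddCommGroup E] [NormedSpace ℂ E]

/-- Evaluation of real polynomials at a bounded operator. -/
def polyOp (B : E →L[ℂ] E) : ℝ[X] →+* (E →L[ℂ] E) :=
  (Polynomial.aeval B : ℂ[X] →ₐ[ℂ] (E →L[ℂ] E)).toRingHom.comp
    (Polynomial.mapRingHom (algebraMap ℝ ℂ))

theorem polyOp_X (B : E →L[ℂ] E) : polyOp B Polynomial.X = B := by
  simp [polyOp]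

theorem polyOp_C (B : E →L[ℂ] E) (a : ℝ) (v : E) : polyOp B (Polynomial.C a) v = (a : ℂ) • v := by
  simp [polyOp, Algebra.algebraMap_eq_smul_one]

theorem polyOp_mul (B : E →L[ℂ] E) (f g : ℝ[X]) (v : E) :
    polyOp B (f * g) v = polyOp B f (polyOp B g v) := by
  rw [map_mul]; rfl

theorem polyOp_add (B : E →L[ℂ] E) (f g : ℝ[X]) (v : E) :
    polyOp B (f + g) v = polyOp B f v + polyOp B g v := by
  rw [map_add]; rfl

theorem polyOp_sub (B : E →L[ℂ] E) (f g : ℝ[X]) (v : E) :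
    polyOp B (f - g) v = polyOp B f v - polyOp B g v := by
  rw [map_sub]; rfl

/-- The zeroth row of `Q_n(A)` is the `n`-th unit row vector. -/
theorem polyOp_Q_apply_zero (hlam : lam ≠ 0) (n : ℕ) (v : ℕ →ᵇ ℂ) :
    polyOp (genOp m lam mu) (Q m lam mu n) v 0 = v n := by
  -- The vector varies because the recurrence also applies `Q_n(A)` to `A v`.
  induction n using Nat.strong_induction_on generalizing v with
  | _ n ih =>
    cases n with
    | zero => rw [Q, map_one]; rfl
    | succ n =>
      have h := congrArg (fun p => polyOp (genOp m lam mu) p v 0) (C_mul_Q_succ m lam mu hlam n)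
      simp only [polyOp_mul, polyOp_sub, polyOp_add, polyOp_C, polyOp_X,
        BoundedContinuousFunction.coe_smul, BoundedContinuousFunction.coe_sub, Pi.sub_apply,
        smul_eq_mul] at h
      rw [ih n (by omega), ih (serve m n) (by have := serve_le m n; omega)] at h
      simp only [BoundedContinuousFunction.coe_smul,
        BoundedContinuousFunction.coe_add, Pi.add_apply, smul_eq_mul, genOp_apply] at h
      have hl : (lam : ℂ) ≠ 0 := by exact_mod_cast hlam
      refine mul_left_cancel₀ hl ?_
      rw [h]; push_cast; ring

/-- The columns of `A` give the unit vectors the same recurrence that defines `q`. -/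
theorem genOp_unitSeq (hm : 1 ≤ m) (s : ℕ) :
    genOp m lam mu (unitSeq s) + ((if s < m then lam else lam + mu : ℝ) : ℂ) • unitSeq s -
      (if s = 0 then 0 else (lam : ℂ) • unitSeq (s - 1)) = (mu : ℂ) • unitSeq (s + m) := by
  ext n
  have h0 : (if s = 0 then 0 else (lam : ℂ) • unitSeq (s - 1)) n =
      if n + 1 = s then (lam : ℂ) else 0 := by
    rcases Nat.eq_zero_or_pos s with rfl | hs
    · simp
    · have : (n = s - 1) ↔ n + 1 = s := by omega
      simp [hs.ne', unitSeq_apply, this]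
  simp only [BoundedContinuousFunction.coe_smul, BoundedContinuousFunction.coe_sub, Pi.sub_apply,
    BoundedContinuousFunction.coe_add, Pi.add_apply, smul_eq_mul, genOp_apply, h0]
  simp only [unitSeq_apply]
  -- The preimages of `s` under `serve m` are `s + m` and, if `s < m`, also `s`; the latter accounts
  -- for the smaller diagonal coefficient.
  have h1 : (mu : ℂ) * (if serve m n = s then 1 else 0) =
      mu * (if n = s + m then 1 else 0) + if n = s ∧ s < m then (mu : ℂ) else 0 := by
    unfold serve
    by_cases hn : n < m
    · have : n ≠ s + m := by omega
      by_cases hs : n = s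
      · subst hs; have hm0 : m ≠ 0 := by omega
        simp [hn, hm0]
      · simp [hn, this, hs]
    · have h2 : n - m = s ↔ n = s + m := by omega
      have h3 : ¬ (n = s ∧ s < m) := by omega
      simp [hn, h2, h3]
  rw [h1]
  by_cases hs : n = s
  · subst hs
    by_cases hn : n < m
    · simp [hn]
    · simp [hn]
  · simp [hs]

/-- The vectors `q_r(A)` generate the unit column vectors. -/
theorem sum_polyOp_q (hm : 1 ≤ m) (hmu : mu ≠ 0) (r : ℕ) :
    ∑ j : Fin m, polyOp (genOp m lam mu) (q m lam mu j r) (unitSeq j) = unitSeq r := by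
  induction r using Nat.strong_induction_on with
  | _ r ih =>
    by_cases hr : r < m
    · rw [Finset.sum_eq_single (⟨r, hr⟩ : Fin m)]
      · rw [q_of_lt m lam mu hr, if_pos rfl, map_one]; rfl
      · intro j _ hj
        rw [q_of_lt m lam mu hr, if_neg (fun h => hj (Fin.ext h.symm)), map_zero]; rfl
      · simp
    · obtain ⟨s, rfl⟩ : ∃ s, r = s + m := ⟨r - m, by omega⟩
      have hl : (mu : ℂ) ≠ 0 := by exact_mod_cast hmu
      refine smul_right_injective _ hl ?_
      simp only [Finset.smul_sum]
      rw [← genOp_unitSeq m lam mu hm s]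
      have hterm : ∀ j : Fin m,
          (mu : ℂ) • polyOp (genOp m lam mu) (q m lam mu j (s + m)) (unitSeq j) =
            genOp m lam mu (polyOp (genOp m lam mu) (q m lam mu j s) (unitSeq j)) +
            ((if s < m then lam else lam + mu : ℝ) : ℂ) •
              polyOp (genOp m lam mu) (q m lam mu j s) (unitSeq j) -
            (if s = 0 then 0 else (lam : ℂ) •
              polyOp (genOp m lam mu) (q m lam mu j (s - 1)) (unitSeq j)) := by
        intro j
        rw [← polyOp_C (genOp m lam mu), ← polyOp_mul, C_mul_q_add m lam mu hm hmu, polyOp_sub,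
          polyOp_mul, polyOp_add, polyOp_X, polyOp_C]
        congr 1
        split_ifs
        · rw [map_zero]; rfl
        · rw [polyOp_mul, polyOp_C]
      rw [Finset.sum_congr rfl fun j _ => hterm j, Finset.sum_sub_distrib, Finset.sum_add_distrib,
        ← map_sum, ← Finset.smul_sum, ih s (by omega)]
      congr 1
      split_ifs with h0
      · simp
      · rw [← Finset.smul_sum, ih (s - 1) (by omega)]

end Polynomials

/-! ### Existence of a biorthogonal system -/

theorem exists_isBiorthogonal (m : ℕ) (hm : 1 ≤ m) (lam mu : ℝ) (hlam : lam ≠ 0) (hmu : mu ≠ 0) :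
    ∃ σ : Fin m → CompactDistribution, IsBiorthogonal m lam mu σ := by
  have hex : ∀ j : Fin m, ∃ T : CompactDistribution, ∀ k : ℕ, T.toLinearMap ⟨fun x => x ^ k,
      mem_smoothFunctions_of_differentiable (differentiable_id.pow k)⟩ =
        (genOp m lam mu ^ k) (unitSeq j) 0 := fun j =>
    exists_compactDistribution_moments _ ‖genOp m lam mu‖ (norm_nonneg _) ‖unitSeq j‖ fun k =>
      (norm_coe_le_norm _ 0).trans ((norm_pow_apply_le _ _ _).trans_eq (mul_comm _ _))
  choose σ hσ using hex
  have hpoly : ∀ (j : Fin m) (p : ℝ[X]), (σ j).toLinearMap ⟨fun x => Polynomial.aeval x p,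
      mem_smoothFunctions_of_differentiable (Polynomial.differentiable_aeval p)⟩ =
        polyOp (genOp m lam mu) p (unitSeq j) 0 := by
    intro j p
    induction p using Polynomial.induction_on' with
    | add f g hf hg =>
      rw [polyOp_add, BoundedContinuousFunction.coe_add, Pi.add_apply, ← hf, ← hg, ← map_add]
      congr 1
      ext x
      simp
    | monomial k a =>
      rw [← Polynomial.C_mul_X_pow_eq_monomial, polyOp_mul, polyOp_C, map_pow, polyOp_X,
        BoundedContinuousFunction.coe_smul]
      beta_reduce
      rw [← hσ, ← map_smul]
      congr 1
      ext x
      simp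
  refine ⟨σ, fun n r => ?_⟩
  -- The factor `Q_n(A)` moves evaluation from index `0` to index `n`.
  have h : ∀ j : Fin m, (σ j).toLinearMap
      ⟨productFun m lam mu n r j, productFun_mem m lam mu n r j⟩ =
      polyOp (genOp m lam mu) (q m lam mu j r) (unitSeq j) n := by
    intro j
    rw [← polyOp_Q_apply_zero m lam mu hlam n, ← polyOp_mul, ← hpoly]
    congr 1
    ext x
    simp [productFun]
  rw [Finset.sum_congr rfl fun j _ => h j, ← Finset.sum_apply,
    ← BoundedContinuousFunction.coe_sum, sum_polyOp_q m lam mu hm hmu, unitSeq_apply]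

/-! ### Moments and the exponential formula -/

theorem differentiable_productFun (m : ℕ) (lam mu : ℝ) (n r j : ℕ) :
    Differentiable ℂ (productFun m lam mu n r j) :=
  (Polynomial.differentiable_aeval _).mul (Polynomial.differentiable_aeval _)

/-- The function `x ↦ x^k Q_n(x) q_{j,r}(x)`. -/
def momentFun (m : ℕ) (lam mu : ℝ) (k n r j : ℕ) : smoothFunctions :=
  ⟨fun x => x ^ k * productFun m lam mu n r j x, mem_smoothFunctions_of_differentiable
    ((differentiable_id.pow k).mul (differentiable_productFun m lam mu n r j))⟩

theorem momentFun_succ (m : ℕ) (lam mu : ℝ) (hlam : lam ≠ 0) (k n r j : ℕ) :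
    momentFun m lam mu (k + 1) n r j = (lam : ℂ) • momentFun m lam mu k (n + 1) r j +
      (mu : ℂ) • momentFun m lam mu k (serve m n) r j -
      ((lam : ℂ) + mu) • momentFun m lam mu k n r j := by
  ext x
  have h := mul_aeval_Q m lam mu hlam n x
  simp only [momentFun, productFun, Submodule.coe_sub, Submodule.coe_add, Submodule.coe_smul,
    Pi.sub_apply, Pi.add_apply, Pi.smul_apply, smul_eq_mul]
  linear_combination x ^ k * Polynomial.aeval x (q m lam mu j r) * h

section Representation

variable {m : ℕ} {lam mu : ℝ} {σ : Fin m → CompactDistribution}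

/-- The moments of a biorthogonal system are the entries of the powers of the generator. -/
theorem IsBiorthogonal.sum_momentFun (hlam : lam ≠ 0) (hσ : IsBiorthogonal m lam mu σ)
    (k n r : ℕ) : ∑ j : Fin m, (σ j).toLinearMap (momentFun m lam mu k n r j) =
      (genOp m lam mu ^ k) (unitSeq r) n := by
  induction k generalizing n with
  | zero =>
    rw [pow_zero, one_apply_eq_self, unitSeq_apply, ← hσ n r]
    refine Finset.sum_congr rfl fun j _ => ?_
    congr 1
    ext x
    simp [momentFun]
  | succ k ih =>
    simp only [momentFun_succ m lam mu hlam, map_sub, map_add, map_smul, smul_eq_mul,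
      Finset.sum_sub_distrib, Finset.sum_add_distrib, ← Finset.mul_sum, ih]
    rw [pow_succ_apply, genOp_apply]

/-- Both sides are limits of the same partial sums, by the moment identity. -/
theorem IsBiorthogonal.P_eq_expOp (hlam : lam ≠ 0) (hσ : IsBiorthogonal m lam mu σ)
    (n r : ℕ) (z : ℂ) : P m lam mu σ n r z = expOp (genOp m lam mu) z (unitSeq r) n := by
  have h1 := tendsto_finsetSum (Finset.univ : Finset (Fin m)) fun j _ =>
    (σ j).tendsto_exp_series (differentiable_productFun m lam mu n r j) z
  have h2 := (hasSum_expOp_apply_apply (genOp m lam mu) z (unitSeq r) n).tendsto_sum_nat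
  rw [← tendsto_nhds_unique (h1.congr fun N => ?_) h2, P]
  · refine Finset.sum_congr rfl fun j _ => ?_
    congr 1
    ext x
    simp [kernelFun, productFun, mul_assoc]
  · rw [Finset.sum_comm]
    refine Finset.sum_congr rfl fun k _ => ?_
    rw [← Finset.mul_sum, ← hσ.sum_momentFun hlam]
    rfl

end Representation

/-! ### Uniqueness -/

/-- A bounded solution of the backward equation with initial value zero vanishes. -/
theorem eq_zero_of_bounded_of_hasDerivWithinAt (m : ℕ) (lam mu : ℝ) (hlam : 0 ≤ lam) (hmu : 0 ≤ mu)
    (D : ℕ → ℝ → ℂ) (K : ℝ) (hK : ∀ n t, 0 ≤ t → ‖D n t‖ ≤ K) (h0 : ∀ n, D n 0 = 0)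
    (hD : ∀ n t, 0 ≤ t → HasDerivWithinAt (D n)
      (lam * D (n + 1) t + mu * D (serve m n) t - (lam + mu) * D n t) (Set.Ici 0) t)
    (n : ℕ) (t : ℝ) (ht : 0 ≤ t) : D n t = 0 := by
  set c : ℝ := 2 * (lam + mu) with hc
  -- The constant `c` bounds the absolute row sums of the equation, so each integration of the
  -- previous bound gains a factor `c t / (k + 1)`.
  have hbound : ∀ k n t, 0 ≤ t → ‖D n t‖ ≤ K * ((c * t) ^ k / k.factorial) := by
    intro k
    induction k with
    | zero => simpa using hK
    | succ k ih =>
      intro n t ht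
      refine image_norm_le_of_norm_deriv_right_le_deriv_boundary
        (f := D n) (a := 0) (b := t)
        (f' := fun t => lam * D (n + 1) t + mu * D (serve m n) t - (lam + mu) * D n t)
        (B := fun t => K * ((c * t) ^ (k + 1) / (k + 1).factorial))
        (B' := fun t => c * (K * ((c * t) ^ k / k.factorial)))
        (fun s hs => ((hD n s hs.1).continuousWithinAt).mono Set.Icc_subset_Ici_self)
        (fun s hs => (hD n s hs.1).mono (Set.Ici_subset_Ici.2 hs.1)) ?_ ?_ ?_ ⟨ht, le_rfl⟩
      · simp [h0]
      · intro s
        have h := ((((hasDerivAt_id s).const_mul c).pow (k + 1)).div_const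
          ((k + 1).factorial : ℝ)).const_mul K
        refine h.congr_deriv ?_
        rw [Nat.factorial_succ]
        have : (k.factorial : ℝ) ≠ 0 := by positivity
        push_cast
        simp only [id]
        field_simp
      · intro s hs
        have e1 := ih (n + 1) s hs.1
        have e2 := ih (serve m n) s hs.1
        have e3 := ih n s hs.1
        calc ‖(lam : ℂ) * D (n + 1) s + mu * D (serve m n) s - (lam + mu) * D n s‖
            ≤ ‖(lam : ℂ) * D (n + 1) s‖ + ‖(mu : ℂ) * D (serve m n) s‖ +
              ‖((lam : ℂ) + mu) * D n s‖ :=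
              (norm_sub_le _ _).trans (add_le_add_left (norm_add_le _ _) _)
          _ = lam * ‖D (n + 1) s‖ + mu * ‖D (serve m n) s‖ + (lam + mu) * ‖D n s‖ := by
              rw [norm_mul, norm_mul, norm_mul, ← Complex.ofReal_add, Complex.norm_real,
                Complex.norm_real, Complex.norm_real, Real.norm_of_nonneg hlam,
                Real.norm_of_nonneg hmu, Real.norm_of_nonneg (add_nonneg hlam hmu)]
          _ ≤ lam * (K * ((c * s) ^ k / k.factorial)) + mu * (K * ((c * s) ^ k / k.factorial)) +
              (lam + mu) * (K * ((c * s) ^ k / k.factorial)) := by gcongr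
          _ = c * (K * ((c * s) ^ k / k.factorial)) := by rw [hc]; ring
  have hlim : Tendsto (fun k : ℕ => K * ((c * t) ^ k / k.factorial)) atTop (𝓝 (K * 0)) :=
    (FloorSemiring.tendsto_pow_div_factorial_atTop (c * t)).const_mul K
  rw [mul_zero] at hlim
  exact norm_le_zero_iff.1 (ge_of_tendsto' hlim fun k => hbound k n t ht)

/-- An entire solution of the backward equation with initial value zero vanishes. -/
theorem eq_zero_of_entire_of_hasDerivWithinAt (m : ℕ) (lam mu : ℝ) (D : ℕ → ℂ → ℂ)
    (hdiff : ∀ n, Differentiable ℂ (D n)) (h0 : ∀ n, D n 0 = 0)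
    (hD : ∀ (n : ℕ) (t : ℝ), 0 ≤ t → HasDerivWithinAt (fun t : ℝ => D n t)
      (lam * D (n + 1) t + mu * D (serve m n) t - (lam + mu) * D n t) (Set.Ici 0) t)
    (n : ℕ) : D n = 0 := by
  have hderiv : ∀ n, deriv (D n) =
      fun z => lam * D (n + 1) z + mu * D (serve m n) z - (lam + mu) * D n z := by
    intro n
    have hd : Differentiable ℂ
        fun z => lam * D (n + 1) z + mu * D (serve m n) z - (lam + mu) * D n z :=
      (((hdiff _).const_mul _).add ((hdiff _).const_mul _)).sub ((hdiff _).const_mul _)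
    -- The equation is known only on `[0, ∞)`; positive reals accumulate at `0`, so the identity
    -- theorem extends it to the plane.
    refine AnalyticOnNhd.eq_of_frequently_eq (z₀ := 0) (fun z _ => (hdiff n).analyticAt z |>.deriv)
      (fun z _ => hd.analyticAt z) ?_
    have ht : Tendsto (fun t : ℝ => (t : ℂ)) (𝓝[>] 0) (𝓝[≠] 0) := by
      refine tendsto_nhdsWithin_iff.2 ⟨?_, ?_⟩
      · exact (Complex.continuous_ofReal.tendsto' 0 0 (by simp)).mono_left nhdsWithin_le_nhds
      · filter_upwards [self_mem_nhdsWithin] with t ht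
        simpa using ne_of_gt ht
    refine ht.frequently (Eventually.frequently ?_)
    filter_upwards [self_mem_nhdsWithin] with t ht
    have ht0 : (0 : ℝ) ≤ t := le_of_lt ht
    have h1 := ((hdiff n t).hasDerivAt.comp_ofReal).hasDerivWithinAt (s := Set.Ici 0)
    exact (uniqueDiffOn_Ici (0 : ℝ) t ht0).eq_deriv _ h1 (hD n t ht0)
  -- The equation expresses derivatives of order `k + 1` at `0` through finitely many of order `k`,
  -- so no bound uniform in `n` is needed.
  have hiter : ∀ k n, iteratedDeriv k (D n) 0 = 0 := by
    intro k
    induction k with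
    | zero => simpa using h0
    | succ k ih =>
      intro n
      have hc : ∀ (a : ℂ) (i : ℕ), ContDiffAt ℂ k (fun z => a * D i z) 0 := fun a i =>
        ((hdiff i).const_mul a).contDiff.contDiffAt
      have hcm : ∀ (a : ℂ) (i : ℕ), iteratedDeriv k (fun z => a * D i z) 0 = 0 := fun a i => by
        rw [iteratedDeriv_const_mul _ (hdiff i).contDiff.contDiffAt, ih, mul_zero]
      rw [iteratedDeriv_succ', hderiv n, iteratedDeriv_fun_sub ((hc _ _).add (hc _ _)) (hc _ _),
        iteratedDeriv_fun_add (hc _ _) (hc _ _), hcm, hcm, hcm]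
      simp
  ext z
  have h := Complex.hasSum_taylorSeries_of_entire (hdiff n) 0 z
  simp only [hiter, smul_zero] at h
  exact h.unique hasSum_zero

/-! ### Properties of `P` and conclusion -/

section Main

variable {m : ℕ} {lam mu : ℝ} {σ : Fin m → CompactDistribution}

theorem IsBiorthogonal.hasDerivAt_P (hlam : lam ≠ 0) (hσ : IsBiorthogonal m lam mu σ)
    (n r : ℕ) (z : ℂ) :
    HasDerivAt (P m lam mu σ n r) (lam * P m lam mu σ (n + 1) r z +
      mu * P m lam mu σ (serve m n) r z - (lam + mu) * P m lam mu σ n r z) z := by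
  have h := hasDerivAt_expOp_genOp_apply m lam mu (unitSeq r) n z
  rw [genOp_apply] at h
  simp only [← hσ.P_eq_expOp hlam] at h
  exact h

theorem IsBiorthogonal.P_zero (hlam : lam ≠ 0) (hσ : IsBiorthogonal m lam mu σ) (n r : ℕ) :
    P m lam mu σ n r 0 = if n = r then 1 else 0 := by
  rw [hσ.P_eq_expOp hlam, expOp_zero, one_apply_eq_self, unitSeq_apply]

theorem IsBiorthogonal.isSolution (hm : 1 ≤ m) (hlam : lam ≠ 0) (hσ : IsBiorthogonal m lam mu σ) :
    IsSolution m lam mu (fun n r t => P m lam mu σ n r (t : ℂ)) where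
  hasDeriv n r t _ := by
    rw [tsum_generator_mul m hm]
    exact (hσ.hasDerivAt_P hlam n r t).comp_ofReal.hasDerivWithinAt
  initial n r := by
    simpa using hσ.P_zero hlam n r

theorem IsSolution.hasDerivWithinAt (hm : 1 ≤ m) {R : ℕ → ℕ → ℝ → ℂ}
    (hR : IsSolution m lam mu R) (n r : ℕ) {t : ℝ} (ht : 0 ≤ t) :
    HasDerivWithinAt (R n r) (lam * R (n + 1) r t + mu * R (serve m n) r t -
      (lam + mu) * R n r t) (Set.Ici 0) t := by
  have h := hR.hasDeriv n r t ht
  rwa [tsum_generator_mul m hm lam mu (fun k => R k r t)] at h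

open ComplexOrder in
theorem IsBiorthogonal.P_nonneg (hlam : 0 < lam) (hmu : 0 < mu) (hσ : IsBiorthogonal m lam mu σ)
    (n r : ℕ) {t : ℝ} (ht : 0 ≤ t) : 0 ≤ P m lam mu σ n r t := by
  rw [hσ.P_eq_expOp hlam.ne']
  refine expOp_genOp_nonneg m lam mu hlam.le hmu.le ht (fun k => ?_) n
  rw [unitSeq_apply]
  split_ifs <;> simp

theorem IsBiorthogonal.P_im (hlam : 0 < lam) (hmu : 0 < mu) (hσ : IsBiorthogonal m lam mu σ)
    (n r : ℕ) {t : ℝ} (ht : 0 ≤ t) : (P m lam mu σ n r t).im = 0 :=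
  (Complex.nonneg_iff.1 (hσ.P_nonneg hlam hmu n r ht)).2.symm

theorem IsBiorthogonal.ofReal_re_P (hlam : 0 < lam) (hmu : 0 < mu)
    (hσ : IsBiorthogonal m lam mu σ) (n r : ℕ) {t : ℝ} (ht : 0 ≤ t) :
    ((P m lam mu σ n r t).re : ℂ) = P m lam mu σ n r t :=
  Complex.ext rfl (hσ.P_im hlam hmu n r ht).symm

theorem IsBiorthogonal.isTransitionFunction (hlam : 0 < lam) (hmu : 0 < mu)
    (hσ : IsBiorthogonal m lam mu σ) :
    IsTransitionFunction (fun n r t => (P m lam mu σ n r (t : ℂ)).re) where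
  nonneg i j t ht := (Complex.nonneg_iff.1 (hσ.P_nonneg hlam hmu i j ht)).1
  initial i j := by
    rw [Complex.ofReal_zero, hσ.P_zero hlam.ne']
    split_ifs <;> simp
  honest i t ht := by
    rw [← Complex.hasSum_ofReal]
    simp only [hσ.ofReal_re_P hlam hmu _ _ ht]
    simp only [hσ.P_eq_expOp hlam.ne']
    -- Row sums are the entries of `exp (tA) 1`, and `A 1 = 0`.
    have h := hasSum_expOp_genOp_mul m lam mu t 1 i
    rw [expOp_genOp_one] at h
    simpa using h
  semigroup i j s t hs ht := by
    rw [← Complex.hasSum_ofReal]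
    simp only [Complex.ofReal_mul, hσ.ofReal_re_P hlam hmu _ _ ht,
      hσ.ofReal_re_P hlam hmu _ _ hs, hσ.ofReal_re_P hlam hmu _ _ (add_nonneg hs ht)]
    simp only [hσ.P_eq_expOp hlam.ne', Complex.ofReal_add, expOp_add]
    exact hasSum_expOp_genOp_mul m lam mu s _ i
  tendsto i j := by
    have hc : Continuous fun t : ℝ => (P m lam mu σ i j (t : ℂ)).re :=
      Complex.continuous_re.comp ((continuous_iff_continuousAt.2 fun z =>
        (hσ.hasDerivAt_P hlam.ne' i j z).continuousAt).comp Complex.continuous_ofReal)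
    refine (hc.tendsto' 0 _ ?_).mono_left nhdsWithin_le_nhds
    rw [Complex.ofReal_zero, hσ.P_zero hlam.ne']
    split_ifs <;> simp

theorem IsTransitionFunction.norm_le_one {p : ℕ → ℕ → ℝ → ℝ} (hp : IsTransitionFunction p)
    (i j : ℕ) {t : ℝ} (ht : 0 ≤ t) : ‖(p i j t : ℂ)‖ ≤ 1 := by
  rw [Complex.norm_real, Real.norm_of_nonneg (hp.nonneg i j t ht)]
  exact le_hasSum (hp.honest i t ht) j fun k _ => hp.nonneg i k t ht

end Main

end BulkQueue

end

theorem theorem1p3 (m : ℕ) (hm : 1 ≤ m) (lam mu : ℝ) (hlam : 0 < lam) (hmu : 0 < mu) :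
    (∃ σ : Fin m → BulkQueue.CompactDistribution, BulkQueue.IsBiorthogonal m lam mu σ) ∧
    ∀ σ : Fin m → BulkQueue.CompactDistribution, BulkQueue.IsBiorthogonal m lam mu σ →
      -- the entries are entire and solve the initial value problem
      (∀ n r : ℕ, Differentiable ℂ (BulkQueue.P m lam mu σ n r)) ∧
      BulkQueue.IsSolution m lam mu (fun n r t => BulkQueue.P m lam mu σ n r (t : ℂ)) ∧
      -- uniqueness among the solutions with entire entries
      (∀ R : ℕ → ℕ → ℂ → ℂ, (∀ n r : ℕ, Differentiable ℂ (R n r)) →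
        BulkQueue.IsSolution m lam mu (fun n r t => R n r (t : ℂ)) →
        R = BulkQueue.P m lam mu σ) ∧
      -- on `[0, ∞)` the entries are real and form a transition probability function
      (∀ (n r : ℕ) (t : ℝ), 0 ≤ t → (BulkQueue.P m lam mu σ n r (t : ℂ)).im = 0) ∧
      BulkQueue.IsTransitionFunction (fun n r t => (BulkQueue.P m lam mu σ n r (t : ℂ)).re) ∧
      -- uniqueness among the solutions that are transition probability functions
      (∀ p : ℕ → ℕ → ℝ → ℝ, BulkQueue.IsTransitionFunction p →
        BulkQueue.IsSolution m lam mu (fun n r t => (p n r t : ℂ)) →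
        ∀ (n r : ℕ) (t : ℝ), 0 ≤ t → (p n r t : ℂ) = BulkQueue.P m lam mu σ n r (t : ℂ)) := by
  refine ⟨BulkQueue.exists_isBiorthogonal m hm lam mu hlam.ne' hmu.ne', fun σ hσ => ?_⟩
  have hdiff : ∀ n r, Differentiable ℂ (BulkQueue.P m lam mu σ n r) := fun n r z =>
    (hσ.hasDerivAt_P hlam.ne' n r z).differentiableAt
  have hsol := hσ.isSolution hm hlam.ne'
  have htrans := hσ.isTransitionFunction hlam hmu
  refine ⟨hdiff, hsol, ?_, fun n r t ht => hσ.P_im hlam hmu n r ht, htrans, ?_⟩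
  · intro R hRd hR
    funext n r
    refine sub_eq_zero.1 (BulkQueue.eq_zero_of_entire_of_hasDerivWithinAt m lam mu
      (fun n => R n r - BulkQueue.P m lam mu σ n r) (fun n => (hRd n r).sub (hdiff n r))
      (fun n => ?_) (fun n t ht => ?_) n)
    · have h1 := hR.initial n r
      have h2 := hsol.initial n r
      simp only [Complex.ofReal_zero] at h1 h2
      rw [Pi.sub_apply, h1, h2, sub_self]
    · refine ((hR.hasDerivWithinAt hm n r ht).sub
        (hsol.hasDerivWithinAt hm n r ht)).congr_deriv ?_
      simp only [Pi.sub_apply]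
      ring
  · intro p hp hps n r t ht
    -- The bound `2` holds because the entries of both transition functions lie in `[0, 1]`.
    refine sub_eq_zero.1 (BulkQueue.eq_zero_of_bounded_of_hasDerivWithinAt m lam mu hlam.le hmu.le
      (fun n t => (p n r t : ℂ) - BulkQueue.P m lam mu σ n r t) 2
      (fun n t ht => ?_) (fun n => ?_) (fun n t ht => ?_) n t ht)
    · have h1 := hp.norm_le_one n r ht
      have h2 := htrans.norm_le_one n r ht
      rw [hσ.ofReal_re_P hlam hmu n r ht] at h2
      exact (norm_sub_le _ _).trans (by linarith)
    · exact sub_eq_zero.2 ((hps.initial n r).trans (hsol.initial n r).symm)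
    · refine ((hps.hasDerivWithinAt hm n r ht).sub
        (hsol.hasDerivWithinAt hm n r ht)).congr_deriv ?_
      ring
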